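/- Let $d$ be a natural number and let $F$ be a finite subset of $SL_d(\overline{\mathbb{Q}})$, with matrix coefficients generating the number field $K$. For a finite set $Q\subset M_d(K)$ put $$h(Q)=\frac{1}{[K:\mathbb{Q}]}\sum_{v}n_v\log^+\|Q\|_v ,\qquad \|Q\|_v=\max_{f\in Q}\|f\|_v ,\qquad \log^+=\max\{0,\log\},$$ where $v$ runs over all places of $K$, $K_v$ is the completion of $K$ at $v$, $n_v$ is the degree of $K_v$ over the closure $\mathbb{Q}_p$ of $\mathbb{Q}$ in it ($p\le\infty$), the absolute value $|\cdot|_v$ extends the standard one of $\mathbb{Q}_p$ (so $|p|_v=1/p$ if $v\mid p<\infty$), and $\|f\|_v$ is the operator norm of $f$ on $K_v^d$ with respect to the sup norm if $v$ is finite and the Euclidean (Hermitian) norm if $v$ is infinite ($\|\emptyset\|_v=0$ and $\log^+0=0$). Let $F^n$ be the set of all products of $n$ elements of $F$. Then the limit $$\widehat{h}(F)=\lim_{n\to\infty}\frac1n h(F^n)$$ (the normalized height of $F$) exists. Moreover, $\widehat{h}(F)=0$ if and only if the group $\langle F\rangle$ generated by $F$ is virtually unipotent, i.e. has a subgroup of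 finite index all of whose elements are unipotent. Equivalently, $\widehat h(F)=0$ if and only if all eigenvalues of all elements of $\langle F\rangle$ are roots of unity. -/

import Mathlib

open scoped Pointwise MatrixGroups ENNReal
open Filter Topology IsDedekindDomain NumberField

namespace NormHeight

/-- The operator norm of a square matrix `A` acting on `𝕜^d`, where `𝕜^d` carries the `ℓ^p` norm
(below: `p = 2` at archimedean places, `p = ∞`, the sup norm, at non-archimedean places). -/
noncomputable def opNorm {𝕜 : Type*} [NormedField 𝕜] {d : ℕ} (p : ℝ≥0∞) [Fact (1 ≤ p)]
    (A : Matrix (Fin d) (Fin d) 𝕜) : ℝ :=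
  sInf {c : ℝ | 0 ≤ c ∧ ∀ x : PiLp p (fun _ : Fin d => 𝕜),
    ‖WithLp.toLp p (A.mulVec (WithLp.ofLp x))‖ ≤ c * ‖x‖}

section LocalNorms

variable {K : Type*} [Field K] [NumberField K] {d : ℕ}

/-- `max_{f ∈ Q} ‖f‖_v` for an infinite place `v`: the operator norm on `M_d(K_v)` for the Euclidean
(Hermitian) norm on `K_v^d`, where `K_v` is the completion of `K` at `v`. -/
noncomputable def infNorm (v : InfinitePlace K) (Q : Set (Matrix (Fin d) (Fin d) K)) : ℝ :=
  sSup ((fun A => opNorm 2 (A.map (algebraMap K v.Completion))) '' Q)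

/-- `max_{f ∈ Q} ‖f‖_v ^ {n_v}` for a finite place `v`: the operator norm on `M_d(K_v)` for the sup
norm on `K_v^d`. Mathlib's absolute value on the completion `K_v` takes the value `N(v)⁻¹` at a
uniformizer, so it is `|x|_v ^ {n_v}`, where `|p|_v = 1 / p` and `n_v = [K_v : ℚ_p]`. The local
degree `n_v` is therefore already part of this quantity. -/
noncomputable def finNorm (v : HeightOneSpectrum (𝓞 K)) (Q : Set (Matrix (Fin d) (Fin d) K)) : ℝ :=
  sSup ((fun A => opNorm ∞ (A.map (FinitePlace.embedding v))) '' Q)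

/-- The height `h(Q) = [K : ℚ]⁻¹ ∑_v n_v log⁺ ‖Q‖_v` of a (finite) set of matrices over `K`. -/
noncomputable def heightOver (Q : Set (Matrix (Fin d) (Fin d) K)) : ℝ :=
  (Module.finrank ℚ K : ℝ)⁻¹ *
    ((∑ v : InfinitePlace K, (v.mult : ℝ) * Real.posLog (infNorm v Q)) +
      ∑ᶠ v : HeightOneSpectrum (𝓞 K), Real.posLog (finNorm v Q))

end LocalNorms

variable {d : ℕ}

/-- The field generated over `ℚ` by the matrix coefficients of the elements of `F`. -/
noncomputable def coeffField (F : Finset SL(d, AlgebraicClosure ℚ)) :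
    IntermediateField ℚ (AlgebraicClosure ℚ) :=
  IntermediateField.adjoin ℚ {x | ∃ A ∈ F, ∃ i j : Fin d, A.1 i j = x}

instance (F : Finset SL(d, AlgebraicClosure ℚ)) : NumberField (coeffField F) where
  to_charZero := inferInstance
  to_finiteDimensional := by
    have hfin : {x | ∃ A ∈ F, ∃ i j : Fin d, A.1 i j = x}.Finite := by
      have : {x | ∃ A ∈ F, ∃ i j : Fin d, A.1 i j = x} =
          ⋃ A ∈ F, ⋃ i : Fin d, ⋃ j : Fin d, {A.1 i j} := by
        ext x; simp [eq_comm]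
      rw [this]
      exact F.finite_toSet.biUnion fun A _ =>
        Set.finite_iUnion fun i => Set.finite_iUnion fun j => Set.finite_singleton _
    have : Finite {x | ∃ A ∈ F, ∃ i j : Fin d, A.1 i j = x} := hfin
    exact IntermediateField.finiteDimensional_adjoin fun x _ =>
      ((AlgebraicClosure.isAlgebraic ℚ).isAlgebraic x).isIntegral

/-- The elements of `F`, viewed as matrices over the coefficient field of `F`. -/
def matrices (F : Finset SL(d, AlgebraicClosure ℚ)) :
    Set (Matrix (Fin d) (Fin d) (coeffField F)) :=
  {M | ∃ A ∈ F, M.map (algebraMap (coeffField F) (AlgebraicClosure ℚ)) = A.1}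

/-- `h(F^n)`, where `F^n` is the set of all products of `n` elements of `F`. -/
noncomputable def heightPow (F : Finset SL(d, AlgebraicClosure ℚ)) (n : ℕ) : ℝ :=
  heightOver (matrices F ^ n)

/-- The normalized height `ĥ(F) = lim_{n → ∞} h(F^n) / n`. -/
noncomputable def normalizedHeight (F : Finset SL(d, AlgebraicClosure ℚ)) : ℝ :=
  limUnder atTop fun n : ℕ => heightPow F n / n

/-- A group of matrices is virtually unipotent if it has a subgroup of finite index all of whose
elements are unipotent. -/
def IsVirtuallyUnipotent (G : Subgroup SL(d, AlgebraicClosure ℚ)) : Prop :=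
  ∃ U : Subgroup G, U.FiniteIndex ∧ ∀ u ∈ U, IsNilpotent ((u : SL(d, AlgebraicClosure ℚ)).1 - 1)

/-- All eigenvalues of all elements of the group are roots of unity. -/
def IsQuasiUnipotent (G : Subgroup SL(d, AlgebraicClosure ℚ)) : Prop :=
  ∀ g ∈ G, ∀ μ : AlgebraicClosure ℚ,
    Module.End.HasEigenvalue (Matrix.toLin' g.1) μ → ∃ m : ℕ, 0 < m ∧ μ ^ m = 1

end NormHeight

namespace NormHeight

/-! ### Operator norms of matrices over a normed field -/

section OpNorm

variable {𝕜 : Type*} [NormedField 𝕜] {d : ℕ} (p : ℝ≥0∞) [Fact (1 ≤ p)]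

/-! Everything passes through one intermediate condition: the traces of the monoid generated by `F`
form a finite set. The limit itself exists by Fekete, since n ↦ h(F^n) is subadditive.

Suppose the limit is 0. Each local term is nonnegative and bounded by [K:ℚ] h(F^n), so the norms
grow subexponentially at every place, and every eigenvalue of every monoid element has absolute
value at most 1 there. Traces are then algebraic integers with all conjugates bounded by d, hence
finite in number (`finite_traces_of_tendsto_height`). If all eigenvalues are roots of unity, the
same finiteness argument applies directly (`finite_traces_of_isQuasiUnipotent`).

Conversely, suppose there are finitely many traces. Modulo the radical of the trace form on the
enveloping algebra the group has finite image, and in characteristic zero that radical is a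
nilpotent ideal. The kernel U has finite index and every u - 1 with u ∈ U lies in this ideal
(`exists_finiteIndex_of_finite_traces`), so the group is virtually unipotent. Schreier rewriting
turns a product of n generators into n factors from a finite subset of U, up to bounded factors.
Expanding ∏(1 + (u - 1)) by nilpotency leaves polynomial growth (`setNorm_pow_le_polynomial`), hence
zero height. -/

lemma opNorm_nonneg (A : Matrix (Fin d) (Fin d) 𝕜) : 0 ≤ opNorm p A :=
  Real.sInf_nonneg fun _ hc => hc.1

lemma opNorm_le {A : Matrix (Fin d) (Fin d) 𝕜} {c : ℝ} (hc : 0 ≤ c)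
    (h : ∀ x : PiLp p (fun _ : Fin d => 𝕜),
      ‖WithLp.toLp p (A.mulVec (WithLp.ofLp x))‖ ≤ c * ‖x‖) : opNorm p A ≤ c :=
  csInf_le ⟨0, fun _ hc => hc.1⟩ ⟨hc, h⟩

/-- The triangle inequality over columns. It makes the set in `opNorm` nonempty, without which its
`sInf` would be the default value 0. -/
lemma exists_mulVec_norm_le (A : Matrix (Fin d) (Fin d) 𝕜) :
    ∃ c : ℝ, 0 ≤ c ∧ ∀ x : PiLp p (fun _ : Fin d => 𝕜),
      ‖WithLp.toLp p (A.mulVec (WithLp.ofLp x))‖ ≤ c * ‖x‖ := by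
  refine ⟨∑ j, ‖WithLp.toLp p (fun i => A i j)‖, by positivity, fun x => ?_⟩
  have : WithLp.toLp p (A.mulVec (WithLp.ofLp x)) =
      ∑ j, x j • WithLp.toLp p (fun i => A i j) := by
    ext i
    simp [Matrix.mulVec, dotProduct, mul_comm]
  rw [this, Finset.sum_mul]
  refine (norm_sum_le _ _).trans (Finset.sum_le_sum fun j _ => ?_)
  rw [norm_smul, mul_comm]
  gcongr
  exact PiLp.norm_apply_le x j

lemma norm_mulVec_le (A : Matrix (Fin d) (Fin d) 𝕜) (x : PiLp p (fun _ : Fin d => 𝕜)) :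
    ‖WithLp.toLp p (A.mulVec (WithLp.ofLp x))‖ ≤ opNorm p A * ‖x‖ := by
  have hne : {c : ℝ | 0 ≤ c ∧ ∀ x : PiLp p (fun _ : Fin d => 𝕜),
    ‖WithLp.toLp p (A.mulVec (WithLp.ofLp x))‖ ≤ c * ‖x‖}.Nonempty := exists_mulVec_norm_le p A
  rcases (norm_nonneg x).eq_or_lt with hx | hx
  · obtain ⟨c, hc⟩ := hne
    have := hc.2 x
    rw [← hx] at this ⊢
    simpa using this
  · rw [← div_le_iff₀ hx]
    exact le_csInf hne fun c hc => (div_le_iff₀ hx).2 (hc.2 x)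

lemma opNorm_mul_le (A B : Matrix (Fin d) (Fin d) 𝕜) :
    opNorm p (A * B) ≤ opNorm p A * opNorm p B := by
  refine opNorm_le p (mul_nonneg (opNorm_nonneg p A) (opNorm_nonneg p B)) fun x => ?_
  rw [← Matrix.mulVec_mulVec, mul_assoc]
  exact (norm_mulVec_le p A (WithLp.toLp p (B.mulVec (WithLp.ofLp x)))).trans
    (mul_le_mul_of_nonneg_left (norm_mulVec_le p B x) (opNorm_nonneg p A))

lemma opNorm_add_le (A B : Matrix (Fin d) (Fin d) 𝕜) :
    opNorm p (A + B) ≤ opNorm p A + opNorm p B := by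
  refine opNorm_le p (add_nonneg (opNorm_nonneg p A) (opNorm_nonneg p B)) fun x => ?_
  rw [Matrix.add_mulVec, WithLp.toLp_add, add_mul]
  exact (norm_add_le _ _).trans (add_le_add (norm_mulVec_le p A x) (norm_mulVec_le p B x))

lemma opNorm_one_le : opNorm p (1 : Matrix (Fin d) (Fin d) 𝕜) ≤ 1 :=
  opNorm_le p zero_le_one fun x => by simp

lemma norm_entry_le_opNorm (A : Matrix (Fin d) (Fin d) 𝕜) (i j : Fin d) :
    ‖A i j‖ ≤ opNorm p A := by
  have h := norm_mulVec_le p A (PiLp.single p j 1)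
  rw [PiLp.norm_single, norm_one, mul_one] at h
  refine le_trans ?_ h
  have := PiLp.norm_apply_le (WithLp.toLp p (A.mulVec (WithLp.ofLp (PiLp.single p j (1 : 𝕜))))) i
  simpa using this

lemma opNorm_top_le_one [IsUltrametricDist 𝕜] {A : Matrix (Fin d) (Fin d) 𝕜}
    (h : ∀ i j, ‖A i j‖ ≤ 1) : opNorm ∞ A ≤ 1 := by
  refine opNorm_le ∞ zero_le_one fun x => ?_
  rw [one_mul, PiLp.norm_toLp]
  refine (pi_norm_le_iff_of_nonneg (norm_nonneg x)).2 fun i => ?_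
  change ‖∑ j, A i j * x j‖ ≤ ‖x‖
  refine IsUltrametricDist.norm_sum_le_of_forall_le_of_nonneg (norm_nonneg x) fun j _ => ?_
  rw [norm_mul]
  exact (mul_le_of_le_one_left (norm_nonneg _) (h i j)).trans (PiLp.norm_apply_le x j)

end OpNorm

lemma finite_pow {M : Type*} [Monoid M] {Q : Set M} (hQ : Q.Finite) (n : ℕ) : (Q ^ n).Finite := by
  induction n with
  | zero => simp
  | succ n ih => rw [pow_succ]; exact ih.mul hQ

/-! ### Maximal norms of sets of matrices -/

section SetNorm

variable {K 𝕜 : Type*} [Field K] [NormedField 𝕜] {d : ℕ} (p : ℝ≥0∞) [Fact (1 ≤ p)] (φ : K →+* 𝕜)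

/-- The maximum over `A ∈ Q` of the operator norm of `φ(A)`; it specializes to `infNorm` and
`finNorm`. -/
noncomputable def setNorm (Q : Set (Matrix (Fin d) (Fin d) K)) : ℝ :=
  sSup ((fun A => opNorm p (A.map φ)) '' Q)

lemma setNorm_nonneg (Q : Set (Matrix (Fin d) (Fin d) K)) : 0 ≤ setNorm p φ Q :=
  Real.sSup_nonneg fun _ ⟨_, _, h⟩ => h ▸ opNorm_nonneg p _

lemma opNorm_le_setNorm {Q : Set (Matrix (Fin d) (Fin d) K)} (hQ : Q.Finite)
    {A : Matrix (Fin d) (Fin d) K} (hA : A ∈ Q) : opNorm p (A.map φ) ≤ setNorm p φ Q :=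
  le_csSup (hQ.image _).bddAbove ⟨A, hA, rfl⟩

/-- Nonnegativity of c covers empty Q, where the supremum is 0. -/
lemma setNorm_le {Q : Set (Matrix (Fin d) (Fin d) K)} {c : ℝ} (hc : 0 ≤ c)
    (h : ∀ A ∈ Q, opNorm p (A.map φ) ≤ c) : setNorm p φ Q ≤ c :=
  Real.sSup_le (fun _ ⟨A, hA, e⟩ => e ▸ h A hA) hc

lemma setNorm_mul_le {P Q : Set (Matrix (Fin d) (Fin d) K)} (hP : P.Finite) (hQ : Q.Finite) :
    setNorm p φ (P * Q) ≤ setNorm p φ P * setNorm p φ Q := by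
  refine setNorm_le p φ (mul_nonneg (setNorm_nonneg p φ P) (setNorm_nonneg p φ Q)) ?_
  rintro _ ⟨A, hA, B, hB, rfl⟩
  simp only [Matrix.map_mul]
  exact (opNorm_mul_le p _ _).trans (mul_le_mul (opNorm_le_setNorm p φ hP hA)
    (opNorm_le_setNorm p φ hQ hB) (opNorm_nonneg p _) (setNorm_nonneg p φ P))

lemma setNorm_one_le : setNorm p φ (1 : Set (Matrix (Fin d) (Fin d) K)) ≤ 1 := by
  refine setNorm_le p φ zero_le_one ?_
  rintro _ rfl
  simpa using opNorm_one_le p (𝕜 := 𝕜)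

lemma setNorm_pow_le_one {Q : Set (Matrix (Fin d) (Fin d) K)} (hQ : Q.Finite)
    (h : setNorm p φ Q ≤ 1) (n : ℕ) : setNorm p φ (Q ^ n) ≤ 1 := by
  induction n with
  | zero => simpa using setNorm_one_le p φ
  | succ n ih =>
    rw [pow_succ]
    exact (setNorm_mul_le p φ (finite_pow hQ _) hQ).trans (mul_le_one₀ ih (setNorm_nonneg p φ Q) h)

lemma posLog_setNorm_mul_le {P Q : Set (Matrix (Fin d) (Fin d) K)} (hP : P.Finite)
    (hQ : Q.Finite) : Real.posLog (setNorm p φ (P * Q)) ≤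
      Real.posLog (setNorm p φ P) + Real.posLog (setNorm p φ Q) :=
  (Real.posLog_le_posLog (setNorm_nonneg p φ _) (setNorm_mul_le p φ hP hQ)).trans Real.posLog_mul

end SetNorm

/-! ### Subadditivity of the height and its local terms -/

section Height

variable {K : Type*} [Field K] [NumberField K] {d : ℕ}

lemma finite_setOf_one_lt_norm (x : K) :
    {v : HeightOneSpectrum (𝓞 K) | 1 < ‖FinitePlace.embedding v x‖}.Finite := by
  rcases eq_or_ne x 0 with rfl | hx
  · convert Set.finite_empty
    ext v
    simp
  · refine ((FinitePlace.hasFiniteMulSupport hx).image FinitePlace.maximalIdeal).subset ?_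
    intro v hv
    refine ⟨FinitePlace.mk v, ?_, FinitePlace.maximalIdeal_mk v⟩
    simp only [Function.mem_mulSupport, FinitePlace.mk_apply]
    exact (ne_of_lt hv).symm

/-- Outside this set of finite places, `‖Q‖_v ≤ 1`. -/
def badPlaces (Q : Set (Matrix (Fin d) (Fin d) K)) : Set (HeightOneSpectrum (𝓞 K)) :=
  ⋃ A ∈ Q, ⋃ i : Fin d, ⋃ j : Fin d, {v | 1 < ‖FinitePlace.embedding v (A i j)‖}

lemma finite_badPlaces {Q : Set (Matrix (Fin d) (Fin d) K)} (hQ : Q.Finite) :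
    (badPlaces Q).Finite :=
  hQ.biUnion fun _ _ => Set.finite_iUnion fun _ => Set.finite_iUnion fun _ =>
    finite_setOf_one_lt_norm _

lemma finNorm_le_one_of_notMem {Q : Set (Matrix (Fin d) (Fin d) K)}
    {v : HeightOneSpectrum (𝓞 K)} (hv : v ∉ badPlaces Q) : finNorm v Q ≤ 1 := by
  refine setNorm_le _ _ zero_le_one fun A hA => opNorm_top_le_one fun i j => ?_
  simp only [badPlaces, Set.mem_iUnion, Set.mem_ofPred_eq, not_exists, not_lt] at hv
  exact hv A hA i j

lemma posLog_eq_zero_of_le_one {x : ℝ} (h0 : 0 ≤ x) (h1 : x ≤ 1) : Real.posLog x = 0 :=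
  (Real.posLog_eq_zero_iff x).2 (by rwa [abs_of_nonneg h0])

/-- Norm at most 1 is inherited by powers, so one finite set of places serves all n at once and the
heights become sums over a fixed index set. -/
lemma support_posLog_finNorm_pow_subset {Q : Set (Matrix (Fin d) (Fin d) K)} (hQ : Q.Finite)
    (n : ℕ) : (Function.support fun v : HeightOneSpectrum (𝓞 K) =>
      Real.posLog (finNorm v (Q ^ n))) ⊆ badPlaces Q := by
  intro v hv
  by_contra h
  exact hv (posLog_eq_zero_of_le_one (setNorm_nonneg _ _ _)
    (setNorm_pow_le_one _ _ hQ (finNorm_le_one_of_notMem h) n))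

lemma heightOver_pow_eq {Q : Set (Matrix (Fin d) (Fin d) K)} (hQ : Q.Finite) (n : ℕ) :
    heightOver (Q ^ n) = (Module.finrank ℚ K : ℝ)⁻¹ *
      ((∑ v : InfinitePlace K, (v.mult : ℝ) * Real.posLog (infNorm v (Q ^ n))) +
      ∑ v ∈ (finite_badPlaces hQ).toFinset, Real.posLog (finNorm v (Q ^ n))) := by
  rw [heightOver, finsum_eq_sum_of_support_subset]
  simpa using support_posLog_finNorm_pow_subset hQ n

lemma heightOver_nonneg (Q : Set (Matrix (Fin d) (Fin d) K)) : 0 ≤ heightOver Q := by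
  refine mul_nonneg (by positivity) (add_nonneg ?_ ?_)
  · exact Finset.sum_nonneg fun v _ => mul_nonneg (by positivity) Real.posLog_nonneg
  · exact finsum_nonneg fun v => Real.posLog_nonneg

lemma subadditive_heightOver_pow {Q : Set (Matrix (Fin d) (Fin d) K)} (hQ : Q.Finite) :
    Subadditive fun n => heightOver (Q ^ n) := by
  intro m n
  simp only [heightOver_pow_eq hQ, ← mul_add]
  simp only [pow_add]
  refine mul_le_mul_of_nonneg_left ?_ (by positivity)
  rw [add_add_add_comm, ← Finset.sum_add_distrib, ← Finset.sum_add_distrib]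
  refine add_le_add (Finset.sum_le_sum fun v _ => ?_) (Finset.sum_le_sum fun v _ => ?_)
  · rw [← mul_add]
    exact mul_le_mul_of_nonneg_left (posLog_setNorm_mul_le _ _ (finite_pow hQ _) (finite_pow hQ _)) (by positivity)
  · exact posLog_setNorm_mul_le _ _ (finite_pow hQ _) (finite_pow hQ _)

lemma tendsto_heightOver_pow {Q : Set (Matrix (Fin d) (Fin d) K)} (hQ : Q.Finite) :
    ∃ l, Tendsto (fun n : ℕ => heightOver (Q ^ n) / n) atTop (𝓝 l) :=
  ⟨_, (subadditive_heightOver_pow hQ).tendsto_lim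
    ⟨0, by rintro _ ⟨n, rfl⟩; exact div_nonneg (heightOver_nonneg _) n.cast_nonneg⟩⟩

lemma posLog_infNorm_le {Q : Set (Matrix (Fin d) (Fin d) K)} (hQ : Q.Finite) (n : ℕ)
    (v : InfinitePlace K) :
    Real.posLog (infNorm v (Q ^ n)) ≤ Module.finrank ℚ K * heightOver (Q ^ n) := by
  have hK : (Module.finrank ℚ K : ℝ) ≠ 0 := by exact_mod_cast Module.finrank_pos.ne'
  rw [heightOver_pow_eq hQ, mul_inv_cancel_left₀ hK]
  refine le_add_of_le_of_nonneg ?_ (Finset.sum_nonneg fun v _ => Real.posLog_nonneg)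
  refine le_trans ?_ (Finset.single_le_sum
    (f := fun v : InfinitePlace K => (v.mult : ℝ) * Real.posLog (infNorm v (Q ^ n)))
    (fun v _ => mul_nonneg (by positivity) Real.posLog_nonneg) (Finset.mem_univ v))
  exact le_mul_of_one_le_left Real.posLog_nonneg (by exact_mod_cast v.mult_pos)

lemma posLog_finNorm_le {Q : Set (Matrix (Fin d) (Fin d) K)} (hQ : Q.Finite) (n : ℕ)
    (v : HeightOneSpectrum (𝓞 K)) :
    Real.posLog (finNorm v (Q ^ n)) ≤ Module.finrank ℚ K * heightOver (Q ^ n) := by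
  have hK : (Module.finrank ℚ K : ℝ) ≠ 0 := by exact_mod_cast Module.finrank_pos.ne'
  by_cases hv : v ∈ badPlaces Q
  · rw [heightOver_pow_eq hQ, mul_inv_cancel_left₀ hK]
    refine le_add_of_nonneg_of_le (Finset.sum_nonneg fun v _ =>
      mul_nonneg (by positivity) Real.posLog_nonneg) ?_
    exact Finset.single_le_sum (f := fun v => Real.posLog (finNorm v (Q ^ n)))
      (fun v _ => Real.posLog_nonneg) ((finite_badPlaces hQ).mem_toFinset.2 hv)
  · have : Real.posLog (finNorm v (Q ^ n)) = 0 := by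
      by_contra h
      exact hv (support_posLog_finNorm_pow_subset hQ n h)
    rw [this]
    exact mul_nonneg (by positivity) (heightOver_nonneg _)

lemma tendsto_div_zero_of_le {u w : ℕ → ℝ} {c : ℝ} (h0 : ∀ n, 0 ≤ u n)
    (h : ∀ n, u n ≤ c * w n) (hw : Tendsto (fun n : ℕ => w n / n) atTop (𝓝 0)) :
    Tendsto (fun n : ℕ => u n / n) atTop (𝓝 0) := by
  refine squeeze_zero (fun n => div_nonneg (h0 n) n.cast_nonneg) (fun n => ?_)
    (by simpa using hw.const_mul c)
  rw [← mul_div_assoc]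
  exact div_le_div_of_nonneg_right (h n) n.cast_nonneg

lemma tendsto_infNorm_of_height {Q : Set (Matrix (Fin d) (Fin d) K)} (hQ : Q.Finite)
    (h : Tendsto (fun n : ℕ => heightOver (Q ^ n) / n) atTop (𝓝 0)) (v : InfinitePlace K) :
    Tendsto (fun n : ℕ => Real.posLog (infNorm v (Q ^ n)) / n) atTop (𝓝 0) :=
  tendsto_div_zero_of_le (fun _ => Real.posLog_nonneg) (fun n => posLog_infNorm_le hQ n v) h

lemma tendsto_finNorm_of_height {Q : Set (Matrix (Fin d) (Fin d) K)} (hQ : Q.Finite)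
    (h : Tendsto (fun n : ℕ => heightOver (Q ^ n) / n) atTop (𝓝 0))
    (v : HeightOneSpectrum (𝓞 K)) :
    Tendsto (fun n : ℕ => Real.posLog (finNorm v (Q ^ n)) / n) atTop (𝓝 0) :=
  tendsto_div_zero_of_le (fun _ => Real.posLog_nonneg) (fun n => posLog_finNorm_le hQ n v) h

lemma tendsto_height_of_norms {Q : Set (Matrix (Fin d) (Fin d) K)} (hQ : Q.Finite)
    (hinf : ∀ v : InfinitePlace K,
      Tendsto (fun n : ℕ => Real.posLog (infNorm v (Q ^ n)) / n) atTop (𝓝 0))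
    (hfin : ∀ v : HeightOneSpectrum (𝓞 K),
      Tendsto (fun n : ℕ => Real.posLog (finNorm v (Q ^ n)) / n) atTop (𝓝 0)) :
    Tendsto (fun n : ℕ => heightOver (Q ^ n) / n) atTop (𝓝 0) := by
  have h1 := tendsto_finsetSum Finset.univ fun v _ => (hinf v).const_mul (v.mult : ℝ)
  have h2 := tendsto_finsetSum (finite_badPlaces hQ).toFinset fun v _ => hfin v
  have h3 := (h1.add h2).const_mul (Module.finrank ℚ K : ℝ)⁻¹
  simp only [mul_zero, Finset.sum_const_zero, add_zero] at h3
  refine h3.congr fun n => ?_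
  rw [heightOver_pow_eq hQ, mul_div_assoc, add_div, Finset.sum_div, Finset.sum_div]
  simp only [mul_div_assoc]

end Height

/-! ### Nilpotency of the radical of the trace form -/

section TraceRadical

variable {k : Type*} [Field k] {d : ℕ}

open Polynomial in
/-- In characteristic zero, a matrix `r` with `tr (r p(r)) = 0` for all polynomials `p` is
nilpotent. -/
lemma isNilpotent_of_trace_mul_aeval [CharZero k] (r : Matrix (Fin d) (Fin d) k)
    (h : ∀ p : k[X], (r * aeval r p).trace = 0) : IsNilpotent r := by
  obtain ⟨q, hq, hX⟩ := r.charpoly.exists_eq_pow_rootMultiplicity_mul_and_not_dvd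
    r.charpoly_monic.ne_zero 0
  set a := r.charpoly.rootMultiplicity 0
  rw [C_0, sub_zero] at hq hX
  -- Fitting decomposition: the Bezout relation makes e = u(r) r^(a+1) the projector onto the part
  -- where r is invertible. The exponent a + 1 rather than a gives e a factor r even when a = 0, so
  -- the hypothesis yields tr e = 0. In characteristic zero an idempotent of trace 0 vanishes.
  have hcop : IsCoprime (X ^ (a + 1)) q :=
    ((irreducible_X.coprime_iff_not_dvd).2 hX).pow_left
  obtain ⟨u, w, huw⟩ := hcop
  have hch : r ^ a * aeval r q = 0 := by
    have := Matrix.aeval_self_charpoly r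
    rw [hq] at this
    simpa using this
  have hr1 : aeval r u * r ^ (a + 1) + aeval r w * aeval r q = 1 := by
    simpa using congrArg (aeval r) huw
  set e := aeval r u * r ^ (a + 1) with he
  have hcomm (p p' : k[X]) : aeval r p * aeval r p' = aeval r p' * aeval r p := by
    rw [← map_mul, ← map_mul, mul_comm]
  have hcr (p : k[X]) (n : ℕ) : aeval r p * r ^ n = r ^ n * aeval r p := by
    simpa using hcomm p (X ^ n)
  have hidem : IsIdempotentElem e := by
    have h1 : e * (aeval r w * aeval r q) = 0 := by
      rw [hcomm w q, he, pow_succ', mul_assoc, mul_assoc, ← mul_assoc (r ^ a), hch]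
      simp
    have h2 : e * (e + aeval r w * aeval r q) = e * 1 := by rw [hr1]
    rwa [mul_add, h1, add_zero, mul_one] at h2
  have htr : e.trace = 0 := by
    have := h (X ^ a * u)
    rw [map_mul, map_pow, aeval_X, ← mul_assoc, ← pow_succ'] at this
    rwa [he, hcr]
  have he0 : e = 0 := by
    have hl : IsIdempotentElem (Matrix.toLin' e) := hidem.map Matrix.toLinAlgEquiv'
    have := LinearMap.IsIdempotentElem.eq_zero_of_trace_eq_zero hl (by simpa using htr)
    simpa using this
  refine ⟨a, ?_⟩
  rw [he0, zero_add] at hr1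
  rw [← mul_one (r ^ a), ← hr1, hcomm w q, ← mul_assoc, hch, zero_mul]

/-- The radical of the trace form on a subalgebra of a matrix algebra. -/
def traceRadical (A : Subalgebra k (Matrix (Fin d) (Fin d) k)) : Ideal A where
  carrier := {a | ∀ b : A, (a.1 * b.1).trace = 0}
  add_mem' {x y} hx hy b := by
    simp only [Set.mem_ofPred_eq] at hx hy
    simp [add_mul, hx b, hy b]
  zero_mem' b := by simp
  smul_mem' c x hx b := by
    have := hx (b * c)
    simp only [MulMemClass.coe_mul, smul_eq_mul] at this ⊢
    rwa [mul_assoc, Matrix.trace_mul_comm, mul_assoc]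

lemma mem_traceRadical {A : Subalgebra k (Matrix (Fin d) (Fin d) k)} {a : A} :
    a ∈ traceRadical A ↔ ∀ b : A, (a.1 * b.1).trace = 0 := Iff.rfl

instance (A : Subalgebra k (Matrix (Fin d) (Fin d) k)) : (traceRadical A).IsTwoSided where
  mul_mem_of_left {a} b ha c := by
    have := ha (b * c)
    rwa [MulMemClass.coe_mul, ← mul_assoc] at this

lemma isNilpotent_of_mem_traceRadical [CharZero k]
    {A : Subalgebra k (Matrix (Fin d) (Fin d) k)} {a : A} (ha : a ∈ traceRadical A) :
    IsNilpotent a := by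
  have : IsNilpotent a.1 := isNilpotent_of_trace_mul_aeval a.1 fun p => by
    have := ha (Polynomial.aeval a p)
    rwa [← A.val_apply (Polynomial.aeval a p), ← Polynomial.aeval_algHom_apply] at this
  obtain ⟨n, hn⟩ := this
  exact ⟨n, Subtype.ext (by simpa using hn)⟩

/-- A nil ideal lies in the Jacobson radical, which is nilpotent because A is finite-dimensional,
hence Artinian. -/
lemma isNilpotent_traceRadical [CharZero k] (A : Subalgebra k (Matrix (Fin d) (Fin d) k)) :
    IsNilpotent (traceRadical A) := by
  have : IsArtinianRing A := IsArtinianRing.of_finite k A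
  obtain ⟨n, hn⟩ := IsArtinianRing.isNilpotent_jacobson_bot (R := A)
  refine ⟨n, le_bot_iff.1 ((Ideal.pow_right_mono ?_ n).trans hn.le)⟩
  intro x hx
  refine Ideal.mem_jacobson_iff.2 fun y => ?_
  have hu : IsUnit (y * x + 1) :=
    (isNilpotent_of_mem_traceRadical ((traceRadical A).mul_mem_left y hx)).isUnit_add_one
  obtain ⟨z, hz⟩ := hu.exists_left_inv
  refine ⟨z, ?_⟩
  rw [mul_add, mul_one, ← mul_assoc] at hz
  simp [hz]

lemma exists_prod_eq_zero_of_mem_traceRadical [CharZero k]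
    (A : Subalgebra k (Matrix (Fin d) (Fin d) k)) :
    ∃ m : ℕ, ∀ l : List A, l.length = m → (∀ a ∈ l, a ∈ traceRadical A) → l.prod = 0 := by
  obtain ⟨m, hm⟩ := isNilpotent_traceRadical A
  refine ⟨m, fun l hl h => ?_⟩
  have key : ∀ l : List A, (∀ a ∈ l, a ∈ traceRadical A) → l.prod ∈ traceRadical A ^ l.length := by
    intro l
    induction l with
    | nil => intro _; simp [Submodule.pow_zero]
    | cons a l ih =>
      intro h
      rw [List.prod_cons, List.length_cons, Ideal.IsTwoSided.pow_succ]
      exact Ideal.mul_mem_mul (h a (by simp)) (ih fun b hb => h b (by simp [hb]))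
  have := key l h
  rw [hl, hm] at this
  simpa using this

end TraceRadical

/-! ### Finitely many traces force a finite-index unipotent subgroup -/

section FiniteTraces

variable {k : Type*} [Field k] {d : ℕ}

/-- Left multiplication by g is injective on the finite-dimensional space A, hence surjective, so it
hits 1. -/
lemma exists_mul_eq_one_of_mem_subalgebra (A : Subalgebra k (Matrix (Fin d) (Fin d) k))
    (g : SL(d, k)) (hg : g.1 ∈ A) : (g⁻¹).1 ∈ A := by
  let f : A →ₗ[k] A := LinearMap.mulLeft k (⟨g.1, hg⟩ : A)
  have hinv : (g⁻¹).1 * g.1 = 1 := by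
    rw [← Matrix.SpecialLinearGroup.coe_mul, inv_mul_cancel]; rfl
  have hf : Function.Injective f := by
    intro x y hxy
    have h1 : g.1 * x.1 = g.1 * y.1 := congrArg Subtype.val hxy
    have h2 := congrArg ((g⁻¹).1 * ·) h1
    simp only [← mul_assoc, hinv, one_mul] at h2
    exact Subtype.ext h2
  obtain ⟨b, hb⟩ := LinearMap.injective_iff_surjective.1 hf 1
  have h1 : g.1 * b.1 = 1 := congrArg Subtype.val hb
  have : (g⁻¹).1 = b.1 := by
    rw [← mul_one (g⁻¹).1, ← h1, ← mul_assoc, hinv, one_mul]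
  exact this ▸ b.2

/-- The enveloping algebra of a set of matrices. -/
def envelope (F : Set SL(d, k)) : Subalgebra k (Matrix (Fin d) (Fin d) k) :=
  Algebra.adjoin k ((fun g : SL(d, k) => g.1) '' F)

lemma coe_mem_envelope {F : Set SL(d, k)} {g : SL(d, k)} (hg : g ∈ Subgroup.closure F) :
    g.1 ∈ envelope F := by
  induction hg using Subgroup.closure_induction with
  | mem x hx => exact Algebra.subset_adjoin ⟨x, hx, rfl⟩
  | one => exact one_mem _
  | mul x y _ _ hx hy => exact mul_mem hx hy
  | inv x _ hx => exact exists_mul_eq_one_of_mem_subalgebra _ x hx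

lemma envelope_eq_span (F : Set SL(d, k)) : Subalgebra.toSubmodule (envelope F) =
    Submodule.span k ((fun g : SL(d, k) => g.1) '' (Submonoid.closure F : Set SL(d, k))) := by
  rw [envelope, Algebra.adjoin_eq_span]
  congr 1
  have := MonoidHom.map_mclosure
    (Matrix.SpecialLinearGroup.coeMonoidHom (R := k) (ι := Fin d)) F
  exact (congrArg (fun M : Submonoid (Matrix (Fin d) (Fin d) k) => SetLike.coe M) this).symm

/-- The group generated by `F`, viewed modulo the radical of the trace form of its envelope. -/
noncomputable def toQuotient (F : Set SL(d, k)) :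
    Subgroup.closure F →* envelope F ⧸ traceRadical (envelope F) where
  toFun g := Ideal.Quotient.mk _ ⟨g.1.1, coe_mem_envelope g.2⟩
  map_one' := by rw [← map_one (Ideal.Quotient.mk _)]; rfl
  map_mul' g h := by rw [← map_mul (Ideal.Quotient.mk _)]; rfl

lemma toQuotient_eq_iff {F : Set SL(d, k)} (g h : Subgroup.closure F) :
    toQuotient F g = toQuotient F h ↔
      ∀ b ∈ envelope F, (g.1.1 * b).trace = (h.1.1 * b).trace := by
  change Ideal.Quotient.mk _ _ = Ideal.Quotient.mk _ _ ↔ _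
  rw [Ideal.Quotient.eq, mem_traceRadical]
  simp [sub_mul, sub_eq_zero]

/-- The class of g is determined by tr(gb) for b in a finite spanning set of the envelope. Choosing
that set inside the monoid keeps gb in the monoid, so each coordinate takes finitely many values. -/
lemma finite_toQuotient_image {F : Set SL(d, k)}
    (hT : ((fun g : SL(d, k) => g.1.trace) '' (Submonoid.closure F : Set SL(d, k))).Finite) :
    (toQuotient F '' {g | g.1 ∈ Submonoid.closure F}).Finite := by
  obtain ⟨s, hsub, hspan⟩ := (Submodule.fg_span_iff_fg_span_finset_subset _).1
    (envelope_eq_span F ▸ IsNoetherian.noetherian (Subalgebra.toSubmodule (envelope F)))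
  rw [← envelope_eq_span] at hspan
  let S : Set (Subgroup.closure F) := {g | g.1 ∈ Submonoid.closure F}
  let c : S → (s → k) := fun g b => (g.1.1.1 * b.1).trace
  let q : S → envelope F ⧸ traceRadical (envelope F) := fun g => toQuotient F g.1
  have hfac : q.FactorsThrough c := by
    intro g h hgh
    refine (toQuotient_eq_iff _ _).2 fun b hb => ?_
    have hb' : b ∈ Submodule.span k (s : Set (Matrix (Fin d) (Fin d) k)) := hspan ▸ hb
    induction hb' using Submodule.span_induction with
    | mem x hx => exact congrFun hgh ⟨x, hx⟩
    | zero => simp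
    | add x y hx hy h1 h2 =>
      simp only [mul_add, Matrix.trace_add]
      rw [h1 (by rw [← Subalgebra.mem_toSubmodule, hspan]; exact hx),
        h2 (by rw [← Subalgebra.mem_toSubmodule, hspan]; exact hy)]
    | smul a x hx h1 =>
      simp only [Matrix.mul_smul, Matrix.trace_smul]
      rw [h1 (by rw [← Subalgebra.mem_toSubmodule, hspan]; exact hx)]
  have hfin : (Set.range c).Finite := by
    refine (Set.Finite.pi' fun _ : s => hT).subset ?_
    rintro _ ⟨g, rfl⟩ b
    obtain ⟨h, hh, hb⟩ := hsub b.2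
    refine ⟨g.1.1 * h, mul_mem g.2 hh, ?_⟩
    simp only [Matrix.SpecialLinearGroup.coe_mul, c, ← hb]
  -- The default value 1 is never used: only arguments in the range of c occur.
  refine (hfin.image (Function.extend c q 1)).subset ?_
  rintro _ ⟨g, hg, rfl⟩
  exact ⟨c ⟨g, hg⟩, ⟨_, rfl⟩, hfac.extend_apply _ _⟩

/-- Elements of a finite submonoid have finite order, so their inverses are already nonnegative
powers. -/
lemma finite_subgroup_closure_of_finite_submonoid_closure {H : Type*} [Group H] {s : Set H}
    (h : (Submonoid.closure s : Set H).Finite) : (Subgroup.closure s : Set H).Finite := by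
  refine h.subset fun x hx => ?_
  induction hx using Subgroup.closure_induction with
  | mem x hx => exact Submonoid.subset_closure hx
  | one => exact one_mem _
  | mul x y _ _ hx hy => exact mul_mem hx hy
  | inv x _ hx =>
    have hfo : IsOfFinOrder x := by
      rw [← finite_powers]
      exact h.subset ((Submonoid.powers_le).2 hx)
    have : x⁻¹ ∈ Submonoid.powers x := by
      rw [hfo.mem_powers_iff_mem_zpowers]
      exact inv_mem (Subgroup.mem_zpowers x)
    exact (Submonoid.powers_le).2 hx this

lemma finite_range_toQuotient {F : Set SL(d, k)}
    (hT : ((fun g : SL(d, k) => g.1.trace) '' (Submonoid.closure F : Set SL(d, k))).Finite) :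
    Finite (toQuotient F).toHomUnits.range := by
  set π := (toQuotient F).toHomUnits
  set F' : Set (Subgroup.closure F) := (↑) ⁻¹' F
  have h1 : π.range = Subgroup.closure (π '' F') := by
    rw [← MonoidHom.map_closure, Subgroup.closure_closure_coe_preimage, MonoidHom.range_eq_map]
  have h2 : (SetLike.coe (Submonoid.closure (π '' F'))).Finite := by
    rw [← MonoidHom.map_mclosure]
    refine Set.Finite.of_finite_image (f := Units.val) ((finite_toQuotient_image hT).subset ?_)
      Units.val_injective.injOn
    rintro _ ⟨_, ⟨g, hg, rfl⟩, rfl⟩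
    refine ⟨g, ?_, rfl⟩
    have hle : Submonoid.closure F' ≤
        (Submonoid.closure F).comap (Subgroup.closure F).subtype :=
      Submonoid.closure_le.2 fun x hx => Submonoid.subset_closure hx
    exact hle hg
  rw [h1]
  exact finite_subgroup_closure_of_finite_submonoid_closure h2

/-- If the traces of the monoid generated by `F` take finitely many values, then the group
generated by `F` has a finite index subgroup `U` such that `{u - 1 | u ∈ U}` generates a nilpotent
algebra. -/
theorem exists_finiteIndex_of_finite_traces [CharZero k] {F : Set SL(d, k)}
    (hT : ((fun g : SL(d, k) => g.1.trace) '' (Submonoid.closure F : Set SL(d, k))).Finite) :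
    ∃ U : Subgroup (Subgroup.closure F), U.FiniteIndex ∧ ∃ m : ℕ,
      ∀ l : List (Matrix (Fin d) (Fin d) k), l.length = m →
        (∀ a ∈ l, ∃ u ∈ U, a = u.1.1 - 1) → l.prod = 0 := by
  have := finite_range_toQuotient hT
  refine ⟨(toQuotient F).toHomUnits.ker, inferInstance, ?_⟩
  obtain ⟨m, hm⟩ := exists_prod_eq_zero_of_mem_traceRadical (envelope F)
  refine ⟨m, fun l hl h => ?_⟩
  have hlift : ∀ a ∈ l, ∃ b ∈ traceRadical (envelope F), b.1 = a := by
    intro a ha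
    obtain ⟨u, hu, rfl⟩ := h a ha
    have h1 : toQuotient F u = 1 := congrArg Units.val hu
    refine ⟨⟨u.1.1, coe_mem_envelope u.2⟩ - 1, ?_, rfl⟩
    rw [← Ideal.Quotient.eq]
    exact h1
  choose! f hf hf' using hlift
  have h0 := hm (l.map f) (by simpa using hl) (by simpa using hf)
  have h1 := congrArg (envelope F).val h0
  rw [map_list_prod, List.map_map, map_zero] at h1
  have h2 : l.map ((envelope F).val ∘ f) = l.map id := List.map_congr_left hf'
  rwa [h2, List.map_id] at h1

end FiniteTraces

/-! ### Polynomial growth from nilpotency -/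

section Growth

/-- In the expansion of ∏(1 + e) only words shorter than m survive, and there are polynomially many.
For the induction, w holds the factors e already selected and j is the number of further ones
allowed before the word reaches length m. -/
lemma prod_one_add_bound {M : Type*} [Ring M] (N : M → ℝ) (h0 : N 0 = 0) (hN : ∀ a, 0 ≤ N a)
    (hone : N 1 ≤ 1) (hmul : ∀ a b, N (a * b) ≤ N a * N b)
    (hadd : ∀ a b, N (a + b) ≤ N a + N b) (E : Set M) {C : ℝ} (hC : 1 ≤ C)
    (hE : ∀ e ∈ E, N e ≤ C) (m : ℕ)
    (hnil : ∀ l : List M, l.length = m → (∀ a ∈ l, a ∈ E) → l.prod = 0)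
    (l : List M) (hl : ∀ a ∈ l, a ∈ E) (j : ℕ) (w : List M) (hw : ∀ a ∈ w, a ∈ E)
    (hj : w.length + j = m) :
    N (w.prod * (l.map (1 + ·)).prod) ≤ C ^ m * ((l.length : ℝ) + 1) ^ j := by
  induction l generalizing j w with
  | nil =>
    have : ∀ w : List M, (∀ a ∈ w, a ∈ E) → N w.prod ≤ C ^ w.length := by
      intro w
      induction w with
      | nil => intro _; simpa using hone
      | cons a w ih =>
        intro h
        rw [List.prod_cons, List.length_cons, pow_succ']
        exact (hmul _ _).trans (mul_le_mul (hE a (h a (by simp)))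
          (ih fun b hb => h b (by simp [hb])) (hN _) (zero_le_one.trans hC))
    simpa using (this w hw).trans (pow_le_pow_right₀ hC (by omega))
  | cons e l ih =>
    have hl' : ∀ a ∈ l, a ∈ E := fun a ha => hl a (by simp [ha])
    rw [List.map_cons, List.prod_cons, List.length_cons]
    rcases j with - | j
    · rw [hnil w (by simpa using hj) hw, zero_mul, h0]
      positivity
    -- Choose 1 or e from the leading factor; the second choice uses up one unit of j. The two
    -- bounds recombine by a Pascal-type inequality.
    · have e1 : w.prod * ((1 + e) * (l.map (1 + ·)).prod) =
          w.prod * (l.map (1 + ·)).prod + (w ++ [e]).prod * (l.map (1 + ·)).prod := by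
        simp only [List.prod_append, List.prod_singleton]
        noncomm_ring
      rw [e1]
      have h1 := ih hl' (j + 1) w hw hj
      have h2 := ih hl' j (w ++ [e]) (by
        intro a ha
        rcases List.mem_append.1 ha with h | h
        · exact hw a h
        · exact hl a (by simp_all)) (by simp; omega)
      have h3 : ((l.length : ℝ) + 1) ^ (j + 1) + ((l.length : ℝ) + 1) ^ j ≤
          ((l.length : ℝ) + 1 + 1) ^ (j + 1) := by
        have : ((l.length : ℝ) + 1) ^ j ≤ ((l.length : ℝ) + 1 + 1) ^ j :=
          pow_le_pow_left₀ (by positivity) (by linarith) j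
        rw [pow_succ, pow_succ ((l.length : ℝ) + 1 + 1)]
        nlinarith [(by positivity : (0 : ℝ) ≤ l.length)]
      push_cast
      calc _ ≤ _ := (hadd _ _).trans (add_le_add h1 h2)
        _ = C ^ m * (((l.length : ℝ) + 1) ^ (j + 1) + ((l.length : ℝ) + 1) ^ j) := by ring
        _ ≤ _ := mul_le_mul_of_nonneg_left h3 (by positivity)

/-- A representative of the right coset `U g`. -/
noncomputable def rightRep {G : Type*} [Group G] (U : Subgroup G) (g : G) : G :=
  (Quotient.out ((g⁻¹ : G) : G ⧸ U))⁻¹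

lemma mul_rightRep_inv_mem {G : Type*} [Group G] (U : Subgroup G) (g : G) :
    g * (rightRep U g)⁻¹ ∈ U := by
  obtain ⟨h, hh⟩ := QuotientGroup.mk_out_eq_mul U g⁻¹
  simp only [rightRep, inv_inv]
  rw [hh, mul_inv_cancel_left]
  exact h.2

lemma finite_range_rightRep {G : Type*} [Group G] (U : Subgroup G) [U.FiniteIndex] :
    (Set.range (rightRep U)).Finite := by
  have : Finite (G ⧸ U) := Subgroup.finite_quotient_of_finiteIndex
  refine (Set.finite_range fun x : G ⧸ U => (Quotient.out x)⁻¹).subset ?_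
  rintro _ ⟨g, rfl⟩
  exact ⟨_, rfl⟩

/-- Schreier rewriting: with r choosing representatives, tf = (tf r(tf)⁻¹) r(tf), where the bracket
lies in U. Each letter produces exactly one factor, so the word length n is preserved. -/
lemma exists_schreier_factorization {G : Type*} [Group G] {F : Set G}
    (U : Subgroup (Subgroup.closure F)) [U.FiniteIndex] (hF : F.Finite) :
    ∃ E T : Set (Subgroup.closure F), E.Finite ∧ T.Finite ∧ E ⊆ U ∧
      ∃ t₀ : Subgroup.closure F, ∀ n, ∀ g ∈ F ^ n, ∃ us : List (Subgroup.closure F),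
        us.length = n ∧ (∀ u ∈ us, u ∈ E) ∧ ∃ t ∈ T, g = (t₀ * us.prod * t : Subgroup.closure F) := by
  set F' : Set (Subgroup.closure F) := (↑) ⁻¹' F
  have hF' : F'.Finite := hF.preimage Subtype.val_injective.injOn
  set T := Set.range (rightRep U)
  have hT : T.Finite := finite_range_rightRep U
  set E := (fun g => g * (rightRep U g)⁻¹) '' (T * F')
  have key : ∀ n, ∀ g ∈ F ^ n, ∀ t ∈ T, ∃ us : List (Subgroup.closure F),
      us.length = n ∧ (∀ u ∈ us, u ∈ E) ∧ ∃ t' ∈ T, (t : G) * g = (us.prod * t' :) := by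
    intro n
    induction n with
    | zero =>
      rintro g hg t ht
      rw [pow_zero, Set.mem_one] at hg
      exact ⟨[], rfl, by simp, t, ht, by simp [hg]⟩
    | succ n ih =>
      intro g hg t ht
      rw [pow_succ'] at hg
      obtain ⟨f, hf, g, hg, rfl⟩ := hg
      let f' : Subgroup.closure F := ⟨f, Subgroup.subset_closure hf⟩
      obtain ⟨us, hlen, hus, t', ht', e⟩ := ih g hg (rightRep U (t * f')) ⟨_, rfl⟩
      refine ⟨t * f' * (rightRep U (t * f'))⁻¹ :: us, by simp [hlen], ?_, t', ht', ?_⟩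
      · simp only [List.mem_cons, forall_eq_or_imp]
        exact ⟨⟨t * f', ⟨t, ht, f', hf, rfl⟩, rfl⟩, hus⟩
      · rw [List.prod_cons, mul_assoc, Subgroup.coe_mul, ← e]
        simp [f', mul_assoc]
  -- The chosen representative of U itself need not be 1, so t₀ undoes it.
  refine ⟨E, T, (hT.mul hF').image _, hT, ?_, (rightRep U 1)⁻¹, fun n g hg => ?_⟩
  · rintro _ ⟨g, -, rfl⟩
    exact mul_rightRep_inv_mem U g
  · obtain ⟨us, hlen, hus, t, ht, e⟩ := key n g hg _ ⟨1, rfl⟩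
    refine ⟨us, hlen, hus, t, ht, ?_⟩
    rw [mul_assoc, Subgroup.coe_mul, ← e]
    simp

lemma setNorm_pow_le_polynomial {K 𝕜 : Type*} [Field K] [CharZero K] [NormedField 𝕜] {d : ℕ}
    (p : ℝ≥0∞) [Fact (1 ≤ p)] (φ : K →+* 𝕜) {F : Set SL(d, K)} (hF : F.Finite)
    (hT : ((fun g : SL(d, K) => g.1.trace) '' (Submonoid.closure F : Set SL(d, K))).Finite) :
    ∃ C : ℝ, ∃ m : ℕ, ∀ n : ℕ, setNorm p φ
      (((fun g : SL(d, K) => g.1) '' F) ^ n) ≤ C * ((n : ℝ) + 1) ^ m := by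
  obtain ⟨U, hU, m, hm⟩ := exists_finiteIndex_of_finite_traces hT
  obtain ⟨E, T, hE, hTf, hEU, t₀, hfac⟩ := exists_schreier_factorization U hF
  let N : Matrix (Fin d) (Fin d) K → ℝ := fun A => opNorm p (A.map φ)
  have hN : ∀ a, 0 ≤ N a := fun a => opNorm_nonneg p _
  have hmul : ∀ a b, N (a * b) ≤ N a * N b := fun a b => by
    simpa only [N, Matrix.map_mul] using opNorm_mul_le p _ _
  let ι : Subgroup.closure F → Matrix (Fin d) (Fin d) K := fun u => u.1.1
  obtain ⟨C, hC⟩ := (hE.image fun u => N (ι u - 1)).bddAbove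
  obtain ⟨D, hD⟩ := (hTf.image fun u => N (ι u)).bddAbove
  set C' := max C 1
  set D' := max D 0
  refine ⟨N (ι t₀) * C' ^ m * D', m, fun n => setNorm_le p φ ?_ ?_⟩
  · have := hN (ι t₀)
    positivity
  intro A hA
  change A ∈ (Matrix.SpecialLinearGroup.coeMonoidHom '' F) ^ n at hA
  rw [← Set.image_pow] at hA
  obtain ⟨g, hg, rfl⟩ := hA
  obtain ⟨us, hlen, hus, t, ht, rfl⟩ := hfac n g hg
  have hprod : ι us.prod = ((us.map fun u => ι u - 1).map (1 + ·)).prod := by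
    rw [List.map_map]
    have : us.map ((1 + ·) ∘ fun u => ι u - 1) = us.map ι :=
      List.map_congr_left fun u _ => by simp
    rw [this]
    exact map_list_prod (Matrix.SpecialLinearGroup.coeMonoidHom.comp (Subgroup.subtype _)) us
  have hb := prod_one_add_bound N (le_antisymm (opNorm_le p le_rfl fun x => by simp) (hN 0)) hN
    (by simpa [N] using opNorm_one_le p (𝕜 := 𝕜)) hmul
    (fun a b => by
      have := opNorm_add_le p (a.map φ) (b.map φ)
      rwa [← Matrix.map_add φ (map_add φ)] at this)
    ((fun u => ι u - 1) '' E) (le_max_right C 1)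
    (by rintro _ ⟨u, hu, rfl⟩; exact (hC ⟨u, hu, rfl⟩).trans (le_max_left _ _)) m
    (fun l hl h => hm l hl fun a ha => by
      obtain ⟨u, hu, rfl⟩ := h a ha
      exact ⟨u, hEU hu, rfl⟩)
    (us.map fun u => ι u - 1)
    (by
      intro a ha
      obtain ⟨u, hu, rfl⟩ := List.mem_map.1 ha
      exact ⟨u, hus u hu, rfl⟩)
    m [] (by simp) (by simp)
  rw [← hprod, List.prod_nil, one_mul, List.length_map, hlen] at hb
  have ht' : N (ι t) ≤ D' := (hD ⟨t, ht, rfl⟩).trans (le_max_left _ _)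
  calc N (ι t₀ * ι us.prod * ι t) ≤ N (ι t₀ * ι us.prod) * N (ι t) := hmul _ _
    _ ≤ (N (ι t₀) * (C' ^ m * ((n : ℝ) + 1) ^ m)) * D' :=
      mul_le_mul ((hmul _ _).trans (mul_le_mul_of_nonneg_left hb (hN _))) ht' (hN _)
        (mul_nonneg (hN _) (by positivity))
    _ = _ := by ring

lemma tendsto_posLog_div_of_le_polynomial {u : ℕ → ℝ} (h0 : ∀ n, 0 ≤ u n)
    (h : ∃ C : ℝ, ∃ m : ℕ, ∀ n : ℕ, u n ≤ C * ((n : ℝ) + 1) ^ m) :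
    Tendsto (fun n : ℕ => Real.posLog (u n) / n) atTop (𝓝 0) := by
  obtain ⟨C, m, h⟩ := h
  have hlog : Tendsto (fun n : ℕ => Real.log ((n : ℝ) + 1) / n) atTop (𝓝 0) := by
    -- The constants give log x / (x - 1), evaluated at x = n + 1.
    have h1 := (Real.tendsto_pow_log_div_mul_add_atTop 1 (-1) 1 one_ne_zero).comp
      (tendsto_atTop_add_const_right atTop (1 : ℝ) tendsto_natCast_atTop_atTop)
    refine h1.congr fun n => ?_
    simp
  have hC : Tendsto (fun n : ℕ => Real.posLog C / n) atTop (𝓝 0) :=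
    tendsto_const_div_atTop_nhds_zero_nat _
  have hsum := hC.add (hlog.const_mul (m : ℝ))
  rw [mul_zero, add_zero] at hsum
  refine squeeze_zero (fun n => div_nonneg Real.posLog_nonneg n.cast_nonneg) (fun n => ?_) hsum
  rw [← mul_div_assoc, ← add_div]
  refine div_le_div_of_nonneg_right ?_ n.cast_nonneg
  refine (Real.posLog_le_posLog (h0 n) (h n)).trans (Real.posLog_mul.trans ?_)
  rw [Real.posLog_pow, Real.posLog_eq_log (x := (n : ℝ) + 1)]
  rw [abs_of_nonneg (by positivity)]
  simp

end Growth

/-! ### Subexponential growth bounds eigenvalues and traces -/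

section Eigenvalues

universe u

/-- Compare norms in the largest coordinate of an eigenvector: that row is a sum of d terms. -/
lemma norm_pow_le_of_isRoot_charpoly {E : Type*} [NormedField E] {d : ℕ}
    (B : Matrix (Fin d) (Fin d) E) {μ : E} (hμ : B.charpoly.IsRoot μ) (k : ℕ) {b : ℝ}
    (hb : ∀ i j, ‖(B ^ k) i j‖ ≤ b) : ‖μ‖ ^ k ≤ d * b := by
  have hev : Module.End.HasEigenvalue (Matrix.toLin' B) μ := by
    rwa [Module.End.hasEigenvalue_iff_isRoot_charpoly, Matrix.charpoly_toLin']
  obtain ⟨x, hx⟩ := hev.exists_hasEigenvector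
  have hpow : (B ^ k).mulVec x = μ ^ k • x := by
    have := hx.pow_apply k
    rwa [← Matrix.toLin'_pow, Matrix.toLin'_apply] at this
  obtain ⟨i₀, hi₀⟩ : ∃ i, x i ≠ 0 := Function.ne_iff.1 hx.2
  obtain ⟨i, -, hi⟩ := Finset.exists_max_image Finset.univ (fun i => ‖x i‖) ⟨i₀, Finset.mem_univ _⟩
  have hpos : 0 < ‖x i‖ := (norm_pos_iff.2 hi₀).trans_le (hi i₀ (Finset.mem_univ _))
  have h1 : ‖μ‖ ^ k * ‖x i‖ = ‖∑ j, (B ^ k) i j * x j‖ := by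
    rw [← norm_pow, ← norm_mul]
    exact congrArg norm (congrFun hpow i).symm
  have h2 : ‖∑ j, (B ^ k) i j * x j‖ ≤ ∑ _j : Fin d, b * ‖x i‖ :=
    (norm_sum_le _ _).trans (Finset.sum_le_sum fun j _ => by
      rw [norm_mul]
      exact mul_le_mul (hb i j) (hi j (Finset.mem_univ _)) (norm_nonneg _)
        ((norm_nonneg _).trans (hb i j)))
  rw [← h1, Finset.sum_const, Finset.card_univ, Fintype.card_fin, nsmul_eq_mul, ← mul_assoc] at h2
  exact le_of_mul_le_mul_right h2 hpos

lemma le_one_of_pow_le_subexponential {x c : ℝ} {b : ℕ → ℝ} (hx : 0 ≤ x)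
    (h : ∀ k, x ^ k ≤ c * b k)
    (hb : Tendsto (fun k : ℕ => Real.posLog (b k) / k) atTop (𝓝 0)) : x ≤ 1 := by
  have hc : Tendsto (fun k : ℕ => Real.posLog c / k) atTop (𝓝 0) :=
    tendsto_const_div_atTop_nhds_zero_nat _
  have hlim := hc.add hb
  rw [add_zero] at hlim
  have hle : Real.posLog x ≤ 0 := by
    refine ge_of_tendsto hlim ?_
    filter_upwards [eventually_gt_atTop 0] with k hk
    have hk' : (0 : ℝ) < k := by exact_mod_cast hk
    rw [← add_div, le_div_iff₀ hk', mul_comm, ← Real.posLog_pow]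
    exact (Real.posLog_le_posLog (pow_nonneg hx k) (h k)).trans Real.posLog_mul
  have := (Real.posLog_eq_zero_iff x).1 (le_antisymm hle Real.posLog_nonneg)
  rwa [abs_of_nonneg hx] at this

/-- Since s^k ∈ Q^(jk), the powers μ^k grow subexponentially in k. The separate field E lets
eigenvalues live in an algebraically closed field while norms are measured in 𝕜. -/
lemma norm_root_charpoly_le_one {K 𝕜 E : Type*} [Field K] [NormedField 𝕜] [NormedField E] {d : ℕ}
    (p : ℝ≥0∞) [Fact (1 ≤ p)] (φ : K →+* 𝕜) (ψ : K →+* E) (hψ : ∀ x, ‖ψ x‖ = ‖φ x‖)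
    {Q : Set (Matrix (Fin d) (Fin d) K)} (hQ : Q.Finite)
    (h : Tendsto (fun n : ℕ => Real.posLog (setNorm p φ (Q ^ n)) / n) atTop (𝓝 0))
    {s : Matrix (Fin d) (Fin d) K} {j : ℕ} (hs : s ∈ Q ^ j) {μ : E}
    (hμ : (s.map ψ).charpoly.IsRoot μ) : ‖μ‖ ≤ 1 := by
  refine le_one_of_pow_le_subexponential (c := d) (b := fun k => setNorm p φ (Q ^ (j * k)))
    (norm_nonneg _) (fun k => ?_) ?_
  · refine norm_pow_le_of_isRoot_charpoly _ hμ k fun i i' => ?_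
    rw [← Matrix.map_pow, Matrix.map_apply, hψ]
    refine (norm_entry_le_opNorm p ((s ^ k).map φ) i i').trans
      (opNorm_le_setNorm p φ (finite_pow hQ _) ?_)
    rw [pow_mul]
    exact Set.pow_mem_pow hs
  -- For j = 0 the indices jk do not tend to infinity, but the sequence is constant before division
  -- by k.
  · rcases Nat.eq_zero_or_pos j with rfl | hj
    · simp only [zero_mul]
      exact tendsto_const_div_atTop_nhds_zero_nat _
    · have h1 := (h.comp (tendsto_id.const_mul_atTop' hj)).const_mul (j : ℝ)
      rw [mul_zero] at h1
      refine h1.congr fun k => ?_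
      have : (j : ℝ) ≠ 0 := by exact_mod_cast hj.ne'
      simp only [Function.comp, id, Nat.cast_mul]
      field_simp

/-- The spectral norm extends the complete nonarchimedean norm to the algebraic closure. -/
lemma exists_isAlgClosed_isometric_extension (L : Type u) [NontriviallyNormedField L]
    [IsUltrametricDist L] [CompleteSpace L] :
    ∃ (E : Type u) (_ : NormedField E) (_ : IsAlgClosed E) (_ : IsUltrametricDist E)
      (i : L →+* E), ∀ x, ‖i x‖ = ‖x‖ := by
  let : NormedField (AlgebraicClosure L) := spectralNorm.normedField L (AlgebraicClosure L)
  refine ⟨AlgebraicClosure L, inferInstance, inferInstance, ?_, algebraMap L _,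
    fun x => spectralNorm_extends x⟩
  exact IsUltrametricDist.isUltrametricDist_of_isNonarchimedean_norm
    (isNonarchimedean_spectralNorm (K := L) (L := AlgebraicClosure L))

lemma norm_multiset_sum_le_one {E : Type*} [NormedField E] [IsUltrametricDist E] (m : Multiset E)
    (h : ∀ x ∈ m, ‖x‖ ≤ 1) : ‖m.sum‖ ≤ 1 := by
  induction m using Multiset.induction_on with
  | empty => simp
  | cons a m ih =>
    rw [Multiset.sum_cons]
    exact (IsUltrametricDist.norm_add_le_max _ _).trans (max_le (h a (by simp))
      (ih fun x hx => h x (by simp [hx])))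

lemma norm_multiset_sum_le_card {E : Type*} [NormedField E] (m : Multiset E)
    (h : ∀ x ∈ m, ‖x‖ ≤ 1) : ‖m.sum‖ ≤ m.card := by
  induction m using Multiset.induction_on with
  | empty => simp
  | cons a m ih =>
    rw [Multiset.sum_cons, Multiset.card_cons, Nat.cast_succ, add_comm]
    exact (norm_add_le _ _).trans (add_le_add (ih fun x hx => h x (by simp [hx])) (h a (by simp)))

lemma map_trace_eq_sum_roots {K E : Type*} [Field K] [Field E] [IsAlgClosed E] {d : ℕ}
    (ψ : K →+* E) (s : Matrix (Fin d) (Fin d) K) :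
    ψ s.trace = (s.map ψ).charpoly.roots.sum := by
  rw [← Matrix.trace_eq_sum_roots_charpoly, AddMonoidHom.map_trace ψ]

variable {K : Type*} [Field K] [NumberField K] {d : ℕ}

lemma exists_one_lt_norm_adicCompletion (v : HeightOneSpectrum (𝓞 K)) :
    ∃ x : v.adicCompletion K, 1 < ‖x‖ := by
  obtain ⟨a, ha, ha0⟩ := Submodule.exists_mem_ne_zero_of_ne_bot v.ne_bot
  refine ⟨(FinitePlace.embedding v (algebraMap (𝓞 K) K a))⁻¹, ?_⟩
  rw [norm_inv]
  refine (one_lt_inv₀ ?_).2 ((FinitePlace.norm_lt_one_iff_mem K v a).2 ha)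
  rw [norm_pos_iff]
  simpa using ha0

lemma norm_embedding_trace_le_one (v : HeightOneSpectrum (𝓞 K))
    {Q : Set (Matrix (Fin d) (Fin d) K)} (hQ : Q.Finite)
    (h : Tendsto (fun n : ℕ => Real.posLog (finNorm v (Q ^ n)) / n) atTop (𝓝 0))
    {s : Matrix (Fin d) (Fin d) K} {j : ℕ} (hs : s ∈ Q ^ j) :
    ‖FinitePlace.embedding v s.trace‖ ≤ 1 := by
  let : NontriviallyNormedField (v.adicCompletion K) :=
    { (inferInstance : NormedField (v.adicCompletion K)) with
      non_trivial := exists_one_lt_norm_adicCompletion v }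
  have : CompleteSpace (v.adicCompletion K) := HeightOneSpectrum.adicCompletion.instCompleteSpace K v
  obtain ⟨E, _, _, _, i, hi⟩ := exists_isAlgClosed_isometric_extension (v.adicCompletion K)
  rw [← hi, ← RingHom.comp_apply, map_trace_eq_sum_roots]
  refine norm_multiset_sum_le_one _ fun μ hμ => ?_
  exact norm_root_charpoly_le_one ∞ (FinitePlace.embedding v) (i.comp (FinitePlace.embedding v))
    (fun x => hi _) hQ h hs (Polynomial.isRoot_of_mem_roots hμ)

omit [NumberField K] in
lemma norm_trace_le_of_roots {E : Type*} [NormedField E] [IsAlgClosed E] (ψ : K →+* E)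
    (s : Matrix (Fin d) (Fin d) K) (h : ∀ μ, (s.map ψ).charpoly.IsRoot μ → ‖μ‖ ≤ 1) :
    ‖ψ s.trace‖ ≤ d := by
  rw [map_trace_eq_sum_roots]
  refine (norm_multiset_sum_le_card _ fun μ hμ => h μ (Polynomial.isRoot_of_mem_roots hμ)).trans ?_
  have := Polynomial.card_roots' (s.map ψ).charpoly
  rw [Matrix.charpoly_natDegree_eq_dim, Fintype.card_fin] at this
  exact_mod_cast this

omit [NumberField K] in
lemma norm_complex_embedding_trace_le (φ : K →+* ℂ)
    {Q : Set (Matrix (Fin d) (Fin d) K)} (hQ : Q.Finite)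
    (h : Tendsto (fun n : ℕ => Real.posLog (infNorm (InfinitePlace.mk φ) (Q ^ n)) / n)
      atTop (𝓝 0))
    {s : Matrix (Fin d) (Fin d) K} {j : ℕ} (hs : s ∈ Q ^ j) : ‖φ s.trace‖ ≤ d :=
  norm_trace_le_of_roots φ s fun _ hμ => norm_root_charpoly_le_one 2
    (algebraMap K (InfinitePlace.mk φ).Completion) φ
    (fun _ => (InfinitePlace.Completion.norm_coe (InfinitePlace.mk φ) _).symm) hQ h hs hμ

lemma isIntegral_of_norm_embedding_le_one {x : K}
    (h : ∀ v : HeightOneSpectrum (𝓞 K), ‖FinitePlace.embedding v x‖ ≤ 1) : IsIntegral ℤ x := by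
  obtain ⟨y, rfl⟩ := HeightOneSpectrum.mem_integers_of_valuation_le_one K _ fun v => by
    have := h v
    rw [FinitePlace.norm_embedding', ← NNReal.coe_one, NNReal.coe_le_coe,
      ← map_one (WithZeroMulInt.toNNReal (HeightOneSpectrum.absNorm_ne_zero v))] at this
    exact (WithZeroMulInt.toNNReal_strictMono
      (HeightOneSpectrum.one_lt_absNorm_nnreal v)).le_iff_le.1 this
  exact RingOfIntegers.isIntegral_coe y

lemma exists_mem_pow_of_mem_closure {M : Type*} [Monoid M] {F : Set M} {s : M}
    (hs : s ∈ Submonoid.closure F) : ∃ j : ℕ, s ∈ F ^ j := by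
  induction hs using Submonoid.closure_induction with
  | mem x hx => exact ⟨1, by simpa using hx⟩
  | one => exact ⟨0, by simp⟩
  | mul x y _ _ hx hy =>
    obtain ⟨i, hi⟩ := hx
    obtain ⟨j, hj⟩ := hy
    exact ⟨i + j, by rw [pow_add]; exact Set.mul_mem_mul hi hj⟩

lemma coe_mem_pow {k : Type*} [Field k] {F : Set SL(d, k)} {j : ℕ} {s : SL(d, k)}
    (hs : s ∈ F ^ j) : s.1 ∈ ((fun g : SL(d, k) => g.1) '' F) ^ j := by
  change Matrix.SpecialLinearGroup.coeMonoidHom s ∈ (Matrix.SpecialLinearGroup.coeMonoidHom '' F) ^ j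
  rw [← Set.image_pow]
  exact ⟨s, hs, rfl⟩

/-- If the normalized height vanishes, then the traces of the monoid generated by `F` take
finitely many values. -/
theorem finite_traces_of_tendsto_height {F : Set SL(d, K)} (hF : F.Finite)
    (h : Tendsto (fun n : ℕ => heightOver (((fun g : SL(d, K) => g.1) '' F) ^ n) / n)
      atTop (𝓝 0)) :
    ((fun g : SL(d, K) => g.1.trace) '' (Submonoid.closure F : Set SL(d, K))).Finite := by
  -- Northcott's finiteness for algebraic integers of K with all complex embeddings bounded by d.
  refine (Embeddings.finite_of_norm_le K ℂ d).subset ?_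
  rintro _ ⟨s, hs, rfl⟩
  obtain ⟨j, hj⟩ := exists_mem_pow_of_mem_closure hs
  have hj' := coe_mem_pow hj
  have hQ := hF.image fun g : SL(d, K) => g.1
  exact ⟨isIntegral_of_norm_embedding_le_one fun v =>
    norm_embedding_trace_le_one v hQ (tendsto_finNorm_of_height hQ h v) hj',
    fun φ => norm_complex_embedding_trace_le φ hQ (tendsto_infNorm_of_height hQ h _) hj'⟩

/-- If the traces of the monoid generated by `F` take finitely many values, then the normalized
height vanishes. -/
theorem tendsto_height_of_finite_traces {F : Set SL(d, K)} (hF : F.Finite)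
    (hT : ((fun g : SL(d, K) => g.1.trace) '' (Submonoid.closure F : Set SL(d, K))).Finite) :
    Tendsto (fun n : ℕ => heightOver (((fun g : SL(d, K) => g.1) '' F) ^ n) / n) atTop (𝓝 0) := by
  refine tendsto_height_of_norms (hF.image _) (fun v => ?_) fun v => ?_
  · exact tendsto_posLog_div_of_le_polynomial (fun n => setNorm_nonneg _ _ _)
      (setNorm_pow_le_polynomial 2 (algebraMap K v.Completion) hF hT)
  · exact tendsto_posLog_div_of_le_polynomial (fun n => setNorm_nonneg _ _ _)
      (setNorm_pow_le_polynomial ∞ (FinitePlace.embedding v) hF hT)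

end Eigenvalues

/-! ### Descent to the coefficient field and the equivalences -/

section CoefficientField

variable {d : ℕ} (F : Finset SL(d, AlgebraicClosure ℚ))

/-- Extension of scalars from the coefficient field to the algebraic closure. -/
noncomputable def extendScalars : SL(d, coeffField F) →* SL(d, AlgebraicClosure ℚ) :=
  Matrix.SpecialLinearGroup.map (algebraMap (coeffField F) (AlgebraicClosure ℚ))

/-- The set `F`, viewed in the special linear group over its coefficient field. -/
def descend : Set SL(d, coeffField F) := extendScalars F ⁻¹' F

lemma coe_extendScalars (g : SL(d, coeffField F)) :
    (extendScalars F g).1 = g.1.map (algebraMap (coeffField F) (AlgebraicClosure ℚ)) := rfl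

lemma extendScalars_injective : Function.Injective (extendScalars F) := by
  intro g h hgh
  refine Subtype.ext (Matrix.map_injective
    (algebraMap (coeffField F) (AlgebraicClosure ℚ)).injective ?_)
  exact congrArg Subtype.val hgh

lemma finite_descend : (descend F).Finite :=
  F.finite_toSet.preimage (extendScalars_injective F).injOn

lemma coe_image_descend : (fun g : SL(d, coeffField F) => g.1) '' descend F = matrices F := by
  ext M
  constructor
  · rintro ⟨g, hg, rfl⟩
    exact ⟨extendScalars F g, hg, rfl⟩
  · rintro ⟨A, hA, hM⟩
    have hdet : M.det = 1 := by
      apply (algebraMap (coeffField F) (AlgebraicClosure ℚ)).injective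
      rw [RingHom.map_det, map_one]
      exact (congrArg Matrix.det hM).trans A.2
    refine ⟨⟨M, hdet⟩, ?_, rfl⟩
    have : extendScalars F ⟨M, hdet⟩ = A := Subtype.ext hM
    change extendScalars F ⟨M, hdet⟩ ∈ (F : Set SL(d, AlgebraicClosure ℚ))
    rw [this]
    exact hA

lemma extendScalars_image_descend : extendScalars F '' descend F = F := by
  rw [descend, Set.image_preimage_eq_iff]
  intro A hA
  have hmem (i j : Fin d) : A.1 i j ∈ coeffField F :=
    IntermediateField.subset_adjoin _ _ ⟨A, hA, i, j, rfl⟩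
  let M : Matrix (Fin d) (Fin d) (coeffField F) := fun i j => ⟨A.1 i j, hmem i j⟩
  have hM : M.map (algebraMap (coeffField F) (AlgebraicClosure ℚ)) = A.1 := rfl
  have hdet : M.det = 1 := by
    apply (algebraMap (coeffField F) (AlgebraicClosure ℚ)).injective
    rw [RingHom.map_det, map_one]
    exact (congrArg Matrix.det hM).trans A.2
  exact ⟨⟨M, hdet⟩, Subtype.ext hM⟩

lemma heightPow_eq (n : ℕ) : heightPow F n =
    heightOver (((fun g : SL(d, coeffField F) => g.1) '' descend F) ^ n) := by
  rw [heightPow, coe_image_descend]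

lemma map_closure_descend : (Submonoid.closure (descend F)).map (extendScalars F) =
    Submonoid.closure (F : Set SL(d, AlgebraicClosure ℚ)) := by
  rw [MonoidHom.map_mclosure, extendScalars_image_descend]

lemma trace_extendScalars (g : SL(d, coeffField F)) : (extendScalars F g).1.trace =
    algebraMap (coeffField F) (AlgebraicClosure ℚ) g.1.trace := by
  rw [coe_extendScalars, AddMonoidHom.map_trace (algebraMap (coeffField F) (AlgebraicClosure ℚ))]

lemma finite_traces_extendScalars
    (h : ((fun g : SL(d, coeffField F) => g.1.trace) ''
      (Submonoid.closure (descend F) : Set SL(d, coeffField F))).Finite) :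
    ((fun g : SL(d, AlgebraicClosure ℚ) => g.1.trace) '' (Submonoid.closure
      (F : Set SL(d, AlgebraicClosure ℚ)) : Set SL(d, AlgebraicClosure ℚ))).Finite := by
  refine (h.image (algebraMap (coeffField F) (AlgebraicClosure ℚ))).subset ?_
  rw [← map_closure_descend]
  rintro _ ⟨_, ⟨g, hg, rfl⟩, rfl⟩
  exact ⟨_, ⟨g, hg, rfl⟩, (trace_extendScalars F g).symm⟩

lemma tendsto_heightPow :
    Tendsto (fun n : ℕ => heightPow F n / n) atTop (𝓝 (normalizedHeight F)) := by
  obtain ⟨l, hl⟩ := tendsto_heightOver_pow ((finite_descend F).image fun g => g.1)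
  simp only [← heightPow_eq] at hl
  rwa [normalizedHeight, hl.limUnder_eq]

lemma normalizedHeight_eq_zero_iff : normalizedHeight F = 0 ↔
    Tendsto (fun n : ℕ => heightPow F n / n) atTop (𝓝 0) :=
  ⟨fun h => h ▸ tendsto_heightPow F, fun h => tendsto_nhds_unique (tendsto_heightPow F) h⟩

lemma normalizedHeight_eq_zero_iff_finite_traces : normalizedHeight F = 0 ↔
    ((fun g : SL(d, coeffField F) => g.1.trace) ''
      (Submonoid.closure (descend F) : Set SL(d, coeffField F))).Finite := by
  rw [normalizedHeight_eq_zero_iff]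
  simp only [heightPow_eq]
  exact ⟨finite_traces_of_tendsto_height (finite_descend F),
    tendsto_height_of_finite_traces (finite_descend F)⟩

lemma isVirtuallyUnipotent_of_finite_traces
    (h : ((fun g : SL(d, AlgebraicClosure ℚ) => g.1.trace) '' (Submonoid.closure
      (F : Set SL(d, AlgebraicClosure ℚ)) : Set SL(d, AlgebraicClosure ℚ))).Finite) :
    IsVirtuallyUnipotent (Subgroup.closure (F : Set SL(d, AlgebraicClosure ℚ))) := by
  obtain ⟨U, hU, m, hm⟩ := exists_finiteIndex_of_finite_traces h
  refine ⟨U, hU, fun u hu => ⟨m, ?_⟩⟩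
  rw [← List.prod_replicate]
  exact hm _ (List.length_replicate) fun a ha => ⟨u, hu, List.eq_of_mem_replicate ha⟩

/-- Some positive power g^n lies in U. Then μ^n - 1 is an eigenvalue of the nilpotent matrix g^n -
1, hence zero. -/
lemma IsVirtuallyUnipotent.isQuasiUnipotent {G : Subgroup SL(d, AlgebraicClosure ℚ)}
    (h : IsVirtuallyUnipotent G) : IsQuasiUnipotent G := by
  obtain ⟨U, hU, hu⟩ := h
  intro g hg μ hμ
  obtain ⟨n, hn, -, hgn⟩ := Subgroup.exists_pow_mem_of_index_ne_zero hU.index_ne_zero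
    (⟨g, hg⟩ : G)
  refine ⟨n, hn, ?_⟩
  obtain ⟨m, hm⟩ := hu _ hgn
  obtain ⟨x, hx⟩ := hμ.exists_hasEigenvector
  have h1 : Module.End.HasEigenvector (Matrix.toLin' (g.1 ^ n - 1)) (μ ^ n - 1) x := by
    refine Module.End.hasEigenvector_iff.2 ⟨Module.End.mem_eigenspace_iff.2 ?_, hx.2⟩
    rw [map_sub, Matrix.toLin'_pow, Matrix.toLin'_one, LinearMap.sub_apply, hx.pow_apply,
      LinearMap.id_apply, sub_smul, one_smul]
  have h2 := h1.pow_apply m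
  rw [← Matrix.toLin'_pow] at h2
  have h3 : (g.1 ^ n - 1) ^ m = 0 := hm
  rw [h3, map_zero, LinearMap.zero_apply] at h2
  have h4 := (smul_eq_zero.1 h2.symm).resolve_right hx.2
  exact sub_eq_zero.1 (eq_zero_of_pow_eq_zero h4)

lemma finite_traces_of_isQuasiUnipotent
    (h : IsQuasiUnipotent (Subgroup.closure (F : Set SL(d, AlgebraicClosure ℚ)))) :
    ((fun g : SL(d, coeffField F) => g.1.trace) ''
      (Submonoid.closure (descend F) : Set SL(d, coeffField F))).Finite := by
  refine (Embeddings.finite_of_norm_le (coeffField F) ℂ d).subset ?_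
  rintro _ ⟨s, hs, rfl⟩
  have hmem : extendScalars F s ∈ Subgroup.closure (F : Set SL(d, AlgebraicClosure ℚ)) := by
    refine Subgroup.le_closure_toSubmonoid _ ?_
    rw [← map_closure_descend]
    exact ⟨s, hs, rfl⟩
  have hroot : ∀ μ ∈ (extendScalars F s).1.charpoly.roots, ∃ m : ℕ, 0 < m ∧ μ ^ m = 1 := by
    intro μ hμ
    refine h _ hmem μ ?_
    rw [Module.End.hasEigenvalue_iff_isRoot_charpoly, Matrix.charpoly_toLin']
    exact Polynomial.isRoot_of_mem_roots hμ
  have htr : algebraMap (coeffField F) (AlgebraicClosure ℚ) s.1.trace =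
      (extendScalars F s).1.charpoly.roots.sum := by
    rw [← trace_extendScalars, Matrix.trace_eq_sum_roots_charpoly]
  constructor
  · rw [← isIntegral_algebraMap_iff (B := AlgebraicClosure ℚ)
      (algebraMap (coeffField F) (AlgebraicClosure ℚ)).injective, htr]
    refine (integralClosure ℤ (AlgebraicClosure ℚ)).multiset_sum_mem fun μ hμ => ?_
    obtain ⟨m, hm, e⟩ := hroot μ hμ
    exact IsIntegral.of_pow hm (e ▸ isIntegral_one)
  · intro φ
    -- Extend φ to the algebraic closure, so that the trace maps to a sum of at most d complex roots
    -- of unity.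
    let _ : Algebra (coeffField F) ℂ := φ.toAlgebra
    have : Algebra.IsAlgebraic (coeffField F) (AlgebraicClosure ℚ) := by
      have : Algebra.IsAlgebraic ℚ (AlgebraicClosure ℚ) := AlgebraicClosure.isAlgebraic ℚ
      exact Algebra.IsAlgebraic.tower_top (K := ℚ) (coeffField F)
    let ψ : AlgebraicClosure ℚ →ₐ[coeffField F] ℂ := IsAlgClosed.lift
    have hψ : φ s.1.trace = ψ (algebraMap (coeffField F) (AlgebraicClosure ℚ) s.1.trace) :=
      (ψ.commutes _).symm
    rw [hψ, htr, map_multiset_sum]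
    refine (norm_multiset_sum_le_card _ fun x hx => ?_).trans ?_
    · obtain ⟨μ, hμ, rfl⟩ := Multiset.mem_map.1 hx
      obtain ⟨m, hm, e⟩ := hroot μ hμ
      refine (Complex.norm_eq_one_of_pow_eq_one (n := m) ?_ hm.ne').le
      rw [← map_pow, e, map_one]
    · rw [Multiset.card_map]
      have := Polynomial.card_roots' (extendScalars F s).1.charpoly
      rw [Matrix.charpoly_natDegree_eq_dim, Fintype.card_fin] at this
      exact_mod_cast this

end CoefficientField

end NormHeight

theorem mainTheorem7 (d : ℕ) (F : Finset SL(d, AlgebraicClosure ℚ)) :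
    Tendsto (fun n : ℕ => NormHeight.heightPow F n / n) atTop (𝓝 (NormHeight.normalizedHeight F)) ∧
    (NormHeight.normalizedHeight F = 0 ↔
      NormHeight.IsVirtuallyUnipotent (Subgroup.closure (F : Set SL(d, AlgebraicClosure ℚ)))) ∧
    (NormHeight.normalizedHeight F = 0 ↔
      NormHeight.IsQuasiUnipotent (Subgroup.closure (F : Set SL(d, AlgebraicClosure ℚ)))) := by
  have h1 : NormHeight.normalizedHeight F = 0 →
      NormHeight.IsVirtuallyUnipotent (Subgroup.closure (F : Set SL(d, AlgebraicClosure ℚ))) :=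
    fun h => NormHeight.isVirtuallyUnipotent_of_finite_traces F
      (NormHeight.finite_traces_extendScalars F
        ((NormHeight.normalizedHeight_eq_zero_iff_finite_traces F).1 h))
  have h2 : NormHeight.IsQuasiUnipotent (Subgroup.closure (F : Set SL(d, AlgebraicClosure ℚ))) →
      NormHeight.normalizedHeight F = 0 := fun h =>
    (NormHeight.normalizedHeight_eq_zero_iff_finite_traces F).2
      (NormHeight.finite_traces_of_isQuasiUnipotent F h)
  exact ⟨NormHeight.tendsto_heightPow F, ⟨h1, fun h => h2 h.isQuasiUnipotent⟩,
    ⟨fun h => (h1 h).isQuasiUnipotent, h2⟩⟩
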